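/- Let $m\in\mathbb{N}$ and let $\mathbb{T}=\mathbb{R}^+=[0,\infty)$ (one-sided time) or $\mathbb{T}=\mathbb{R}$ (two-sided time). Let $\Omega=\mathcal{C}_0(\mathbb{T},\mathbb{R}^m)$ be the space of continuous paths $\omega:\mathbb{T}\to\mathbb{R}^m$ with $\omega(0)=0$, with the topology of uniform convergence on compact sets, let $\mathcal{F}$ be its Borel $\sigma$-algebra, and let $\mathbb{P}$ be Wiener measure on $(\Omega,\mathcal{F})$, i.e. the probability measure under which the coordinate process $W_t(\omega)=\omega(t)$ has independent increments with $W_t-W_s\sim\mathcal{N}(0,|t-s|I)$ for all $s,t\in\mathbb{T}$. For $t\in\mathbb{T}$ let $\theta_t:\Omega\to\Omega$, $(\theta_t\omega)(s)=\omega(s+t)-\omega(t)$, be the Wiener shift. Then $\Sigma=(\Omega,\mathcal{F},\mathbb{P},(\theta_t)_{t\in\mathbb{T}})$ is an ergodic metric dynamical system: $(t,\omega)\mapsto\theta_t\omega$ is measurable, $\theta_0=\mathrm{id}$, $\theta_{s+t}=\theta_s\circ\theta_t$, every $\theta_t$ preserves $\mathbb{P}$, and every $A\in\mathcal{F}$ with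 $\theta_t^{-1}A=A$ for all $t\in\mathbb{T}$ satisfies $\mathbb{P}(A)\in\{0,1\}$. Moreover, for every $\tau>0$ the discrete-time system $\Sigma^\tau=(\Omega,\mathcal{F},\mathbb{P},(\theta_\tau^n)_{n\ge 0})$ is ergodic: $\theta_\tau$ preserves $\mathbb{P}$ and every $A\in\mathcal{F}$ with $\theta_\tau^{-1}A=A$ satisfies $\mathbb{P}(A)\in\{0,1\}$. -/

import Mathlib

open MeasureTheory ProbabilityTheory
open scoped NNReal

/-- The space `C₀(T, ℝ^m)` of continuous paths `ω : T → ℝ^m` with `ω 0 = 0`. -/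
def WienerSpace (T : Type*) [TopologicalSpace T] [Zero T] (m : ℕ) : Type _ :=
  {ω : C(T, EuclideanSpace ℝ (Fin m)) // ω 0 = 0}

namespace WienerSpace

section Basic

variable {T : Type*} [TopologicalSpace T] [Zero T] {m : ℕ}

/-- The topology of uniform convergence on compact sets (the compact-open topology). -/
instance : TopologicalSpace (WienerSpace T m) :=
  inferInstanceAs (TopologicalSpace {ω : C(T, EuclideanSpace ℝ (Fin m)) // ω 0 = 0})

/-- The Borel σ-algebra of the compact-open topology. -/
instance : MeasurableSpace (WienerSpace T m) := borel _

instance : BorelSpace (WienerSpace T m) := ⟨rfl⟩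

/-- The canonical (coordinate) process `W_t(ω) = ω(t)`. -/
def coord (t : T) (ω : WienerSpace T m) : EuclideanSpace ℝ (Fin m) := ω.1 t

end Basic

section Shift

variable {T : Type*} [TopologicalSpace T] [AddMonoid T] [ContinuousAdd T] {m : ℕ}

/-- The Wiener shift `(θ_t ω)(s) = ω(s + t) - ω(t)`. -/
def shift (t : T) (ω : WienerSpace T m) : WienerSpace T m :=
  ⟨⟨fun s => ω.1 (s + t) - ω.1 t, by fun_prop⟩, by simp⟩

end Shift

end WienerSpace

/-- `P` is Wiener measure on `C₀(T, ℝ^m)`: under `P` the coordinate process (which is continuous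
and starts at `0`) has independent increments, and `W_t - W_s ∼ N(0, |t - s| I)`.
It is used for `T = ℝ≥0` and `T = ℝ`, where `dist t s = |t - s|`. -/
structure IsWienerMeasure {T : Type*} [PseudoMetricSpace T] [Zero T] [Preorder T] {m : ℕ}
    (P : Measure (WienerSpace T m)) : Prop where
  indep_increments : HasIndepIncrements (WienerSpace.coord (T := T) (m := m)) P
  law_increment : ∀ s t : T,
    HasLaw (fun ω => WienerSpace.coord t ω - WienerSpace.coord s ω)
      (multivariateGaussian 0 (dist t s • (1 : Matrix (Fin m) (Fin m) ℝ))) P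

/-- `(Ω, F, P, (θ_t)_{t ∈ T})` is a metric dynamical system: `P` is a probability measure and
`θ` is a jointly measurable action of the additive monoid `T` on `Ω` preserving `P`. -/
structure IsMetricDynamicalSystem {T Ω : Type*} [AddMonoid T] [MeasurableSpace T]
    [MeasurableSpace Ω] (P : Measure Ω) (θ : T → Ω → Ω) : Prop where
  isProbabilityMeasure : IsProbabilityMeasure P
  measurable_uncurry : Measurable (fun p : T × Ω => θ p.1 p.2)
  map_zero : θ 0 = id
  map_add : ∀ s t : T, θ (s + t) = θ s ∘ θ t
  measurePreserving : ∀ t : T, MeasurePreserving (θ t) P P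

/-- The metric dynamical system `(Ω, F, P, (θ_t)_{t ∈ T})` is ergodic: every measurable set `A`
with `θ_t⁻¹ A = A` for all `t ∈ T` has probability `0` or `1`. -/
structure IsErgodicMetricDynamicalSystem {T Ω : Type*} [AddMonoid T] [MeasurableSpace T]
    [MeasurableSpace Ω] (P : Measure Ω) (θ : T → Ω → Ω) : Prop
    extends IsMetricDynamicalSystem P θ where
  measure_eq_zero_or_one : ∀ A : Set Ω, MeasurableSet A → (∀ t : T, θ t ⁻¹' A = A) →
    P A = 0 ∨ P A = 1

/-! The shift `θ_τ` is mixing. A cylinder event is a condition on finitely many increments from time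
`0`, and its preimage under `θ_{nτ}` is the same condition on increments from time `nτ`. For large
`n` these come after every time that a second cylinder event involves, so by independence
(`indepFun_past_future`) the two events are exactly independent. Two π-λ arguments extend the limit
to all measurable sets, and an invariant `A` paired with itself satisfies `P A = (P A)²`. A set
invariant under every `θ_t` is invariant under one `θ_τ`, which covers continuous time.

`P` is invariant because its image under a shift is again a Wiener measure and Wiener measure is
`unique`. Both arguments rest on cylinders generating the Borel σ-algebra
(`generateFrom_cylinders`). -/

open Filter Topology

/-! ### Mixing on a π-system and triviality of invariant sets -/

section Mixing

variable {Ω : Type*} {mΩ : MeasurableSpace Ω} {μ : Measure Ω} {f : ℕ → Ω → Ω}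

lemma hasSum_measureReal_iUnion [IsFiniteMeasure μ] {g : ℕ → Set Ω}
    (hm : ∀ i, MeasurableSet (g i)) (hd : Pairwise (Function.onFun Disjoint g)) :
    HasSum (fun i => μ.real (g i)) (μ.real (⋃ i, g i)) := by
  have h := measure_iUnion hd hm (μ := μ)
  simp only [measureReal_def, h, ENNReal.tsum_toReal_eq fun i => measure_ne_top μ (g i)]
  exact ENNReal.hasSum_toReal (h ▸ measure_ne_top μ _)

/-- If `μ (fₙ⁻¹ A ∩ B) → μ A * μ B` for `A` in a generating π-system, then for all measurable
`A`. -/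
lemma tendsto_measureReal_preimage_inter_of_generateFrom_left [IsProbabilityMeasure μ]
    {C : Set (Set Ω)} (hgen : mΩ = MeasurableSpace.generateFrom C) (hpi : IsPiSystem C)
    (hf : ∀ n, MeasurePreserving (f n) μ μ) {B : Set Ω} (hB : MeasurableSet B)
    (h : ∀ A ∈ C, Tendsto (fun n => μ.real (f n ⁻¹' A ∩ B)) atTop (𝓝 (μ.real A * μ.real B)))
    {A : Set Ω} (hA : MeasurableSet A) :
    Tendsto (fun n => μ.real (f n ⁻¹' A ∩ B)) atTop (𝓝 (μ.real A * μ.real B)) := by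
  induction A, hA using MeasurableSpace.induction_on_inter hgen hpi with
  | empty => simp
  | basic t ht => exact h t ht
  | compl t htm ih =>
    have key : ∀ n, μ.real (f n ⁻¹' tᶜ ∩ B) = μ.real B - μ.real (f n ⁻¹' t ∩ B) := fun n => by
      have := measureReal_inter_add_sdiff (μ := μ) (s := B) ((hf n).measurable htm)
      rw [Set.preimage_compl, Set.inter_comm, ← Set.sdiff_eq, Set.inter_comm _ B]
      linarith
    simp_rw [key, probReal_compl_eq_one_sub htm, sub_mul, one_mul]
    exact tendsto_const_nhds.sub ih
  | iUnion g hd hgm ih =>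
    have hsum : HasSum (fun i => μ.real (g i)) (μ.real (⋃ i, g i)) :=
      hasSum_measureReal_iUnion hgm hd
    have key : ∀ n, μ.real (f n ⁻¹' (⋃ i, g i) ∩ B) = ∑' i, μ.real (f n ⁻¹' g i ∩ B) := fun n => by
      rw [Set.preimage_iUnion, Set.iUnion_inter]
      refine (hasSum_measureReal_iUnion
        (fun i => ((hf n).measurable (hgm i)).inter hB) ?_).tsum_eq.symm
      exact fun i j hij => ((hd hij).preimage (f n)).mono Set.inter_subset_left Set.inter_subset_left
    simp_rw [key]
    rw [← (hsum.mul_right _).tsum_eq]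
    -- Measure preservation supplies the summable bound `μ (g i)`, uniform in `n`.
    refine tendsto_tsum_of_dominated_convergence hsum.summable ih (.of_forall fun n i => ?_)
    rw [Real.norm_of_nonneg measureReal_nonneg,
      ← (hf n).measureReal_preimage (hgm i).nullMeasurableSet]
    exact measureReal_mono Set.inter_subset_left

/-- If `μ (fₙ⁻¹ A ∩ B) → μ A * μ B` for `B` in a generating π-system, then for all measurable
`B`. -/
lemma tendsto_measureReal_preimage_inter_of_generateFrom_right [IsProbabilityMeasure μ]
    {C : Set (Set Ω)} (hgen : mΩ = MeasurableSpace.generateFrom C) (hpi : IsPiSystem C)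
    (hf : ∀ n, MeasurePreserving (f n) μ μ) {A : Set Ω} (hA : MeasurableSet A)
    (h : ∀ B ∈ C, Tendsto (fun n => μ.real (f n ⁻¹' A ∩ B)) atTop (𝓝 (μ.real A * μ.real B)))
    {B : Set Ω} (hB : MeasurableSet B) :
    Tendsto (fun n => μ.real (f n ⁻¹' A ∩ B)) atTop (𝓝 (μ.real A * μ.real B)) := by
  induction B, hB using MeasurableSpace.induction_on_inter hgen hpi with
  | empty => simp
  | basic t ht => exact h t ht
  | compl t htm ih =>
    have key : ∀ n, μ.real (f n ⁻¹' A ∩ tᶜ) = μ.real A - μ.real (f n ⁻¹' A ∩ t) := fun n => by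
      have := measureReal_inter_add_sdiff (μ := μ) (s := f n ⁻¹' A) htm
      rw [← Set.sdiff_eq, ← (hf n).measureReal_preimage hA.nullMeasurableSet]
      linarith
    simp_rw [key, probReal_compl_eq_one_sub htm, mul_sub, mul_one]
    exact tendsto_const_nhds.sub ih
  | iUnion g hd hgm ih =>
    have hsum : HasSum (fun i => μ.real (g i)) (μ.real (⋃ i, g i)) :=
      hasSum_measureReal_iUnion hgm hd
    have key : ∀ n, μ.real (f n ⁻¹' A ∩ (⋃ i, g i)) = ∑' i, μ.real (f n ⁻¹' A ∩ g i) := fun n => by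
      rw [Set.inter_iUnion]
      refine (hasSum_measureReal_iUnion
        (fun i => ((hf n).measurable hA).inter (hgm i)) ?_).tsum_eq.symm
      exact fun i j hij => (hd hij).mono Set.inter_subset_right Set.inter_subset_right
    simp_rw [key]
    rw [← (hsum.mul_left _).tsum_eq]
    refine tendsto_tsum_of_dominated_convergence hsum.summable ih (.of_forall fun n i => ?_)
    rw [Real.norm_of_nonneg measureReal_nonneg]
    exact measureReal_mono Set.inter_subset_right

/-- Mixing along a sequence of measure preserving maps, checked on a generating π-system, implies
that the invariant sets are trivial. -/
lemma measure_eq_zero_or_one_of_mixing [IsProbabilityMeasure μ]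
    {C : Set (Set Ω)} (hgen : mΩ = MeasurableSpace.generateFrom C) (hpi : IsPiSystem C)
    (hf : ∀ n, MeasurePreserving (f n) μ μ)
    (h : ∀ A ∈ C, ∀ B ∈ C,
      Tendsto (fun n => μ.real (f n ⁻¹' A ∩ B)) atTop (𝓝 (μ.real A * μ.real B)))
    {A : Set Ω} (hA : MeasurableSet A) (hinv : ∀ n, f n ⁻¹' A = A) : μ A = 0 ∨ μ A = 1 := by
  have hC : ∀ s ∈ C, MeasurableSet s := fun s hs => hgen ▸ .basic s hs
  have hlim := tendsto_measureReal_preimage_inter_of_generateFrom_right hgen hpi hf hA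
    (fun B hB => tendsto_measureReal_preimage_inter_of_generateFrom_left hgen hpi hf (hC B hB)
      (fun A hA => h A hA B hB) hA) hA
  simp only [hinv, Set.inter_self] at hlim
  have heq : μ.real A = μ.real A * μ.real A := tendsto_nhds_unique tendsto_const_nhds hlim
  have : μ.real A = 0 ∨ μ.real A = 1 := by
    rcases eq_or_ne (μ.real A) 0 with h0 | h0
    · exact .inl h0
    · exact .inr (mul_left_cancel₀ h0 (by linarith))
  refine this.imp (fun h0 => (measureReal_eq_zero_iff).1 h0) fun h1 => ?_
  rw [← ofReal_measureReal (μ := μ) (s := A), h1, ENNReal.ofReal_one]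

end Mixing

/-! ### The Borel σ-algebra of the compact-open topology -/

section BorelContinuousMap

open Set in
/-- The Borel σ-algebra of the compact-open topology is generated by the evaluations. -/
lemma ContinuousMap.borel_eq_comap_coe {X Y : Type*} [PseudoMetricSpace X]
    [SecondCountableTopology X] [LocallyCompactSpace X] [PseudoMetricSpace Y]
    [SecondCountableTopology Y] [MeasurableSpace Y] [BorelSpace Y] :
    borel C(X, Y) = MeasurableSpace.comap (fun (f : C(X, Y)) x => f x) MeasurableSpace.pi := by
  apply le_antisymm
  · rw [borel_eq_generateFrom_of_subbasis ContinuousMap.compactOpen_eq]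
    refine MeasurableSpace.generateFrom_le ?_
    rintro _ ⟨K, hK, U, hU, rfl⟩
    obtain ⟨D, hDK, hDc, hKD⟩ := hK.isSeparable.exists_countable_dense_subset
    -- `F n` is the closed set of points at distance at least `1/(n+1)` from `Uᶜ`. The compact image
    -- of `K` lies in `U` iff it lies in some `F n`, and closedness lets this be tested on the
    -- countable dense `D`.
    let F : ℕ → Set Y := fun n => (Metric.thickening (1 / ((n : ℝ) + 1)) Uᶜ)ᶜ
    have hF : ∀ n, IsClosed (F n) := fun n => Metric.isOpen_thickening.isClosed_compl
    have heq : {f : C(X, Y) | MapsTo f K U}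
        = (fun (f : C(X, Y)) x => f x) ⁻¹' (⋃ n, ⋂ q ∈ D, {g : X → Y | g q ∈ F n}) := by
      ext f
      simp only [mem_ofPred_eq, mem_preimage, mem_iUnion, mem_iInter]
      constructor
      · intro h
        obtain ⟨δ, hδ, hsub⟩ := (hK.image f.continuous).exists_thickening_subset_open hU
          h.image_subset
        obtain ⟨n, hn⟩ := exists_nat_one_div_lt hδ
        refine ⟨n, fun q hq hmem => ?_⟩
        obtain ⟨z, hz, hzd⟩ := Metric.mem_thickening_iff.1 hmem
        refine hz (hsub (Metric.mem_thickening_iff.2 ⟨f q, mem_image_of_mem _ (hDK hq), ?_⟩))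
        rw [dist_comm]
        exact hzd.trans hn
      · rintro ⟨n, hn⟩ x hx
        have : f x ∈ F n :=
          closure_minimal (s := D) (t := f ⁻¹' F n) hn ((hF n).preimage f.continuous) (hKD hx)
        by_contra hxU
        exact this (Metric.self_subset_thickening (by positivity) _ hxU)
    refine ⟨_, ?_, heq.symm⟩
    exact .iUnion fun n => .biInter hDc fun q _ => measurable_pi_apply q (hF n).measurableSet
  · borelize C(X, Y)
    exact Measurable.comap_le (measurable_pi_lambda _ fun x => (continuous_eval_const x).measurable)

end BorelContinuousMap

/-! ### Processes with independent increments -/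

section Increments

/-- A nonempty finite subset of a linear order is contained in the range of a monotone sequence. -/
lemma Finset.exists_monotone_nat_range {T : Type*} [LinearOrder T] (S : Finset T)
    (hS : S.Nonempty) : ∃ t : ℕ → T, Monotone t ∧ ∀ u ∈ S, ∃ i, t i = u := by
  have hc : 0 < S.card := hS.card_pos
  -- The increasing enumeration of `S`, continued constantly at its maximum.
  refine ⟨fun i => S.orderEmbOfFin rfl ⟨min i (S.card - 1), by omega⟩, fun i j hij => ?_,
    fun u hu => ?_⟩
  · exact (S.orderEmbOfFin rfl).monotone (by simp; omega)
  · obtain ⟨⟨i, hi⟩, rfl⟩ : u ∈ Set.range (S.orderEmbOfFin rfl) := by simpa using hu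
    exact ⟨i, congrArg _ (Fin.ext (by simp only; omega))⟩

/-- A monotone sequence may repeat values, so an order between times does not order their indices;
the index has to be changed. -/
lemma Monotone.exists_le_of_apply_le {T : Type*} [PartialOrder T] {t : ℕ → T} (ht : Monotone t)
    {i k : ℕ} (h : t i ≤ t k) : ∃ j ≤ k, t j = t i := by
  rcases le_total i k with hik | hik
  · exact ⟨i, hik, rfl⟩
  · exact ⟨k, le_rfl, (ht hik).antisymm h⟩

lemma Monotone.exists_ge_of_le_apply {T : Type*} [PartialOrder T] {t : ℕ → T} (ht : Monotone t)
    {i k : ℕ} (h : t k ≤ t i) : ∃ j ≥ k, t j = t i := by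
  rcases le_total k i with hik | hik
  · exact ⟨i, hik, rfl⟩
  · exact ⟨k, le_rfl, h.antisymm (ht hik)⟩

variable {T Ω E : Type*} {mΩ : MeasurableSpace Ω} {P : Measure Ω} {X : T → Ω → E}
  [LinearOrder T] [AddCommGroup E] [MeasurableSpace E] [MeasurableAdd₂ E]

/-- Increments along times between `t a` and `t b` are measurable with respect to the σ-algebra
generated by the elementary increments indexed by a set containing `[a, b)`. -/
lemma measurable_sub_of_Ico_subset {T : Type*} {X : T → Ω → E} (t : ℕ → T) {I : Set ℕ} {a b : ℕ}
    (hab : a ≤ b) (hI : Set.Ico a b ⊆ I) :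
    Measurable[⨆ i ∈ I, MeasurableSpace.comap (fun ω => X (t (i + 1)) ω - X (t i) ω) inferInstance]
      (fun ω => X (t b) ω - X (t a) ω) := by
  simp_rw [fun ω => (Finset.sum_Ico_sub (fun i => X (t i) ω) hab).symm]
  refine Finset.measurable_fun_sum _ fun i hi => ?_
  exact (comap_measurable _).mono (le_iSup₂_of_le i (hI (by simpa using hi)) le_rfl) le_rfl

variable [MeasurableSub₂ E]

/-- Increments before time `M` are independent of increments after time `M`. -/
lemma ProbabilityTheory.HasIndepIncrements.indepFun_past_future (h : HasIndepIncrements X P)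
    (hX : ∀ t, Measurable (X t)) {S₁ S₂ : Finset T} {p q M : T} (hp : p ≤ M) (hq : M ≤ q)
    (h₁ : ∀ u ∈ S₁, u ≤ M) (h₂ : ∀ u ∈ S₂, M ≤ u) :
    IndepFun (fun ω (u : S₁) => X u ω - X p ω) (fun ω (u : S₂) => X u ω - X q ω) P := by
  obtain ⟨t, ht, htS⟩ := ((S₁ ∪ S₂) ∪ {p, q, M}).exists_monotone_nat_range ⟨p, by simp⟩
  obtain ⟨k, rfl⟩ := htS M (by simp)
  set m : ℕ → MeasurableSpace Ω :=
    fun i => MeasurableSpace.comap (fun ω => X (t (i + 1)) ω - X (t i) ω) inferInstance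
  -- All times lie on one grid, cut at the index `k` of `M`; past and future use disjoint blocks of
  -- elementary increments.
  have hind : Indep (⨆ i ∈ Set.Iio k, m i) (⨆ i ∈ Set.Ici k, m i) P :=
    indep_iSup_of_disjoint (fun i => ((hX _).sub (hX _)).comap_le)
      ((iIndepFun_iff_iIndep ..).1 (h.nat ht))
      (Set.disjoint_left.2 fun i hi hi' => (Set.mem_Iio.1 hi).not_ge hi')
  have past : ∀ v ∈ (S₁ ∪ S₂) ∪ {p, q, t k}, v ≤ t k →
      Measurable[⨆ i ∈ Set.Iio k, m i] (fun ω => X (t k) ω - X v ω) := fun v hv hvk => by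
    obtain ⟨j, rfl⟩ := htS v hv
    obtain ⟨i, hik, hi⟩ := ht.exists_le_of_apply_le hvk
    rw [← hi]
    exact measurable_sub_of_Ico_subset t hik fun x hx => hx.2
  have future : ∀ v ∈ (S₁ ∪ S₂) ∪ {p, q, t k}, t k ≤ v →
      Measurable[⨆ i ∈ Set.Ici k, m i] (fun ω => X v ω - X (t k) ω) := fun v hv hvk => by
    obtain ⟨j, rfl⟩ := htS v hv
    obtain ⟨i, hik, hi⟩ := ht.exists_ge_of_le_apply hvk
    rw [← hi]
    exact measurable_sub_of_Ico_subset t hik fun x hx => hx.1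
  refine (IndepFun_iff_Indep ..).2 (indep_of_indep_of_le_left
    (indep_of_indep_of_le_right hind (Measurable.comap_le ?_)) (Measurable.comap_le ?_))
  · refine @measurable_pi_lambda _ _ _ (_) _ _ fun u => ?_
    have := (future u (by simp) (h₂ u u.2)).sub (future q (by simp) hq)
    simpa [Pi.sub_def] using this
  · refine @measurable_pi_lambda _ _ _ (_) _ _ fun u => ?_
    have := (past p (by simp) hp).sub (past u (by simp) (h₁ u u.2))
    simpa [Pi.sub_def] using this

/-- The finite-dimensional laws of a process with independent increments, started at a base
point, are determined by the laws of the increments. -/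
lemma ProbabilityTheory.HasIndepIncrements.map_sub_eq {Ω' : Type*} {mΩ' : MeasurableSpace Ω'}
    {P' : Measure Ω'} {X' : T → Ω' → E} (h : HasIndepIncrements X P)
    (h' : HasIndepIncrements X' P') (hX : ∀ t, Measurable (X t)) (hX' : ∀ t, Measurable (X' t))
    (hlaw : ∀ s t, P.map (fun ω => X t ω - X s ω) = P'.map (fun ω => X' t ω - X' s ω))
    (S : Finset T) (p : T) :
    P.map (fun ω (u : S) => X u ω - X p ω) = P'.map (fun ω (u : S) => X' u ω - X' p ω) := by
  obtain ⟨t, ht, htS⟩ := (S ∪ {p}).exists_monotone_nat_range ⟨p, by simp⟩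
  obtain ⟨a, rfl⟩ := htS p (by simp)
  choose b hb using fun u : S => htS u (by simp)
  -- `G` rebuilds `X u - X p` from the elementary increments by telescoping from `t 0`, so the law
  -- is the image of a product of increment laws.
  let G : (ℕ → E) → S → E := fun x u => ∑ i ∈ Finset.range (b u), x i - ∑ i ∈ Finset.range a, x i
  have hG : Measurable G := by fun_prop
  have hfac : ∀ x : ℕ → E, (fun u : S => x (b u) - x a) = G (fun i => x (i + 1) - x i) := fun x => by
    funext u
    simp only [G, Finset.sum_range_sub]
    abel
  have e₁ : (fun ω (u : S) => X u ω - X (t a) ω)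
      = G ∘ fun ω i => X (t (i + 1)) ω - X (t i) ω := by
    funext ω
    simpa [hb] using hfac fun i => X (t i) ω
  have e₂ : (fun ω (u : S) => X' u ω - X' (t a) ω)
      = G ∘ fun ω i => X' (t (i + 1)) ω - X' (t i) ω := by
    funext ω
    simpa [hb] using hfac fun i => X' (t i) ω
  rw [e₁, e₂, ← Measure.map_map hG (by fun_prop), ← Measure.map_map hG (by fun_prop),
    (h.nat ht).map_fun_eq_infinitePi_map (fun i => by fun_prop),
    (h'.nat ht).map_fun_eq_infinitePi_map (fun i => by fun_prop)]
  simp_rw [hlaw]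

end Increments

/-! ### Cylinder events, measurability and the shift action -/

namespace WienerSpace

section Coord

variable {T : Type*} [TopologicalSpace T] [Zero T] {m : ℕ}

@[simp]
lemma coord_zero (ω : WienerSpace T m) : coord 0 ω = 0 := ω.2

lemma ext_coord {ω ω' : WienerSpace T m} (h : ∀ t, coord t ω = coord t ω') : ω = ω' :=
  Subtype.ext (ContinuousMap.ext h)

lemma continuous_coe : Continuous fun ω : WienerSpace T m => ω.1 :=
  continuous_subtype_val (p := fun ω : C(T, EuclideanSpace ℝ (Fin m)) => ω 0 = 0)

lemma measurable_coord (t : T) : Measurable (coord t : WienerSpace T m → _) :=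
  Continuous.measurable ((continuous_eval_const t).comp continuous_coe)

/-- The π-system of events depending on finitely many coordinates. -/
def cylinders (T : Type*) [TopologicalSpace T] [Zero T] (m : ℕ) : Set (Set (WienerSpace T m)) :=
  {A | ∃ B ∈ measurableCylinders fun _ : T => EuclideanSpace ℝ (Fin m),
    (fun ω t => coord t ω) ⁻¹' B = A}

lemma isPiSystem_cylinders : IsPiSystem (cylinders T m) :=
  isPiSystem_measurableCylinders.comap _

/-- Subtracting the vanishing `coord 0` puts the event in terms of increments, the form that the
shift and independence act on. -/
lemma exists_of_mem_cylinders {A : Set (WienerSpace T m)} (hA : A ∈ cylinders T m) :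
    ∃ (S : Finset T) (B : Set (S → EuclideanSpace ℝ (Fin m))), MeasurableSet B ∧
      A = (fun ω (u : S) => coord (u : T) ω - coord 0 ω) ⁻¹' B := by
  obtain ⟨_, hC, rfl⟩ := hA
  obtain ⟨S, B, hB, rfl⟩ := (mem_measurableCylinders _).1 hC
  refine ⟨S, B, hB, ?_⟩
  simp only [coord_zero, sub_zero]
  rfl

end Coord

section Measurability

variable {T : Type*} [PseudoMetricSpace T] [SecondCountableTopology T] [LocallyCompactSpace T]
  [Zero T] {m : ℕ}

instance : SecondCountableTopology (WienerSpace T m) :=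
  Topology.IsInducing.secondCountableTopology
    (f := fun ω : WienerSpace T m => ω.1) ⟨rfl⟩

/-- The σ-algebra on the path space is generated by the coordinate process. -/
lemma measurableSpace_eq_comap_coord :
    (instMeasurableSpace : MeasurableSpace (WienerSpace T m)) =
      MeasurableSpace.comap (fun ω t => coord t ω) MeasurableSpace.pi := by
  change borel (WienerSpace T m) = _
  have h : borel (WienerSpace T m) = (borel C(T, EuclideanSpace ℝ (Fin m))).comap Subtype.val :=
    borel_comap
  rw [h, ContinuousMap.borel_eq_comap_coe, MeasurableSpace.comap_comp]
  rfl

lemma measurable_iff_coord {α : Type*} [MeasurableSpace α] {f : α → WienerSpace T m} :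
    Measurable f ↔ ∀ t, Measurable fun a => coord t (f a) := by
  refine ⟨fun h t => (measurable_coord t).comp h, fun h => ?_⟩
  rw [measurable_iff_comap_le, measurableSpace_eq_comap_coord, MeasurableSpace.comap_comp,
    ← measurable_iff_comap_le]
  exact measurable_pi_lambda _ h

lemma generateFrom_cylinders :
    (instMeasurableSpace : MeasurableSpace (WienerSpace T m)) =
      MeasurableSpace.generateFrom (cylinders T m) := by
  rw [measurableSpace_eq_comap_coord, ← generateFrom_measurableCylinders,
    MeasurableSpace.comap_generateFrom]
  rfl

end Measurability

section Shift

variable {T : Type*} [TopologicalSpace T] [AddCommMonoid T] [ContinuousAdd T] {m : ℕ}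

lemma coord_shift (s t : T) (ω : WienerSpace T m) :
    coord s (shift t ω) = coord (s + t) ω - coord t ω := rfl

lemma shift_zero : (shift 0 : WienerSpace T m → WienerSpace T m) = id :=
  funext fun ω => ext_coord fun t => by simp [coord_shift, coord_zero]

lemma shift_add (s t : T) :
    (shift (s + t) : WienerSpace T m → WienerSpace T m) = shift s ∘ shift t :=
  funext fun ω => ext_coord fun u => by simp [coord_shift, add_assoc]

lemma shift_iterate (t : T) (n : ℕ) :
    (shift t : WienerSpace T m → WienerSpace T m)^[n] = shift (n • t) := by
  induction n with
  | zero => simp [shift_zero]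
  | succ n ih => rw [Function.iterate_succ, ih, succ_nsmul, shift_add]

/-- Evaluation is jointly continuous because `T` is locally compact. -/
lemma measurable_uncurry_shift {T : Type*} [PseudoMetricSpace T] [SecondCountableTopology T]
    [LocallyCompactSpace T] [AddCommMonoid T] [ContinuousAdd T] [MeasurableSpace T] [BorelSpace T] :
    Measurable fun p : T × WienerSpace T m => shift p.1 p.2 := by
  refine measurable_iff_coord.2 fun s => Continuous.measurable ?_
  have h : Continuous fun p : T × WienerSpace T m => (p.2.1, s + p.1) := by
    exact (continuous_coe.comp continuous_snd).prodMk (by fun_prop)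
  have h' : Continuous fun p : T × WienerSpace T m => (p.2.1, p.1) :=
    (continuous_coe.comp continuous_snd).prodMk continuous_fst
  exact (continuous_eval.comp h).sub (continuous_eval.comp h')

lemma measurable_shift {T : Type*} [PseudoMetricSpace T] [SecondCountableTopology T]
    [LocallyCompactSpace T] [AddCommMonoid T] [ContinuousAdd T] (t : T) :
    Measurable (shift t : WienerSpace T m → WienerSpace T m) :=
  measurable_iff_coord.2 fun _ => (measurable_coord _).sub (measurable_coord _)

end Shift

end WienerSpace

/-- Independence is a property of the joint law alone. -/
lemma ProbabilityTheory.iIndepFun_map {ι Ω Ω' E : Type*} [Fintype ι] [MeasurableSpace Ω]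
    [MeasurableSpace Ω'] [MeasurableSpace E] {P : Measure Ω} {g : Ω → Ω'} (hg : Measurable g)
    {X : ι → Ω' → E} (hX : ∀ i, Measurable (X i)) (h : iIndepFun (fun i => X i ∘ g) P) :
    iIndepFun X (P.map g) := by
  have := h.isProbabilityMeasure
  have := Measure.isProbabilityMeasure_map (μ := P) hg.aemeasurable
  rw [iIndepFun_iff_map_fun_eq_pi_map fun i => (hX i).aemeasurable,
    Measure.map_map (measurable_pi_lambda _ hX) hg]
  simp_rw [Measure.map_map (hX _) hg]
  exact (iIndepFun_iff_map_fun_eq_pi_map fun i => ((hX i).comp hg).aemeasurable).1 h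

/-! ### Uniqueness, invariance and ergodicity of Wiener measure -/

namespace IsWienerMeasure

open WienerSpace

variable {T : Type*} [PseudoMetricSpace T] [LinearOrder T] {m : ℕ}

lemma isProbabilityMeasure [Zero T] {P : Measure (WienerSpace T m)} (hP : IsWienerMeasure P) :
    IsProbabilityMeasure P :=
  -- Independence of the empty family of increments already forces total mass `1`.
  (hP.indep_increments 0 (fun _ => 0) monotone_const).isProbabilityMeasure

variable [SecondCountableTopology T] [LocallyCompactSpace T]

/-- Wiener measure is unique. -/
lemma unique [Zero T] {P Q : Measure (WienerSpace T m)} (hP : IsWienerMeasure P)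
    (hQ : IsWienerMeasure Q) : P = Q := by
  have := hP.isProbabilityMeasure
  have := hQ.isProbabilityMeasure
  refine ext_of_generate_finite _ generateFrom_cylinders isPiSystem_cylinders (fun A hA => ?_)
    (by simp)
  obtain ⟨S, B, hB, rfl⟩ := exists_of_mem_cylinders hA
  have hmeas : Measurable fun (ω : WienerSpace T m) (u : S) => coord (u : T) ω - coord 0 ω :=
    measurable_pi_lambda _ fun u => (measurable_coord _).sub (measurable_coord _)
  rw [← Measure.map_apply hmeas hB, ← Measure.map_apply hmeas hB,
    hP.indep_increments.map_sub_eq hQ.indep_increments measurable_coord measurable_coord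
      (fun s t => (hP.law_increment s t).map_eq.trans (hQ.law_increment s t).map_eq.symm) S 0]

variable [AddCommMonoid T] [ContinuousAdd T] [IsOrderedAddMonoid T] {P : Measure (WienerSpace T m)}

/-- The image of Wiener measure under a shift is a Wiener measure. -/
lemma map_shift (hdist : ∀ s t u : T, dist (s + u) (t + u) = dist s t) (hP : IsWienerMeasure P)
    (c : T) : IsWienerMeasure (P.map (shift c)) where
  indep_increments n t ht := by
    have h := hP.indep_increments n (fun i => t i + c) (ht.add_const c)
    refine iIndepFun_map (measurable_shift c)
      (fun i => (measurable_coord _).sub (measurable_coord _)) ?_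
    simpa [coord_shift, Function.comp_def] using h
  law_increment s t := by
    have h := hP.law_increment (s + c) (t + c)
    have hm : Measurable fun ω : WienerSpace T m => coord t ω - coord s ω :=
      (measurable_coord _).sub (measurable_coord _)
    refine ⟨hm.aemeasurable, ?_⟩
    rw [Measure.map_map hm (measurable_shift c),
      ← hdist t s c, ← h.map_eq]
    congr 1
    funext ω
    simp [coord_shift]

lemma measurePreserving_shift (hdist : ∀ s t u : T, dist (s + u) (t + u) = dist s t)
    (hP : IsWienerMeasure P) (c : T) : MeasurePreserving (shift c) P P :=
  ⟨measurable_shift c, (hP.map_shift hdist c).unique hP⟩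

/-- The shift by a positive time has trivial invariant sets. -/
lemma measure_eq_zero_or_one (hdist : ∀ s t u : T, dist (s + u) (t + u) = dist s t)
    (hP : IsWienerMeasure P) {τ : T} (hτ : ∀ u : T, Tendsto (fun n : ℕ => u + n • τ) atTop atTop)
    {A : Set (WienerSpace T m)} (hA : MeasurableSet A) (hinv : shift τ ⁻¹' A = A) :
    P A = 0 ∨ P A = 1 := by
  have := hP.isProbabilityMeasure
  refine measure_eq_zero_or_one_of_mixing (f := fun n => shift (n • τ)) generateFrom_cylinders
    isPiSystem_cylinders (fun n => hP.measurePreserving_shift hdist _) ?_ hA fun n => ?_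
  · intro A hAC B hBC
    obtain ⟨S, A, hA, rfl⟩ := exists_of_mem_cylinders hAC
    obtain ⟨R, B, hB, rfl⟩ := exists_of_mem_cylinders hBC
    -- The base point `0` is inserted in `R`, and below in `S`, so that `0 ≤ M ≤ n • τ` holds as
    -- well.
    obtain ⟨M, hM⟩ := (insert 0 R).exists_le
    have hev : ∀ᶠ n : ℕ in atTop, ∀ u ∈ insert 0 S, M ≤ u + n • τ :=
      (Filter.eventually_all_finset _).2 fun u _ => (hτ u).eventually_ge_atTop M
    -- The sequence is eventually equal to its limit.
    refine tendsto_const_nhds.congr' (hev.mono fun n hn => ?_)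
    have hind := hP.indep_increments.indepFun_past_future measurable_coord (S₁ := R)
      (S₂ := S.image (· + n • τ)) (p := 0) (q := n • τ) (M := M) (hM 0 (by simp))
      (by simpa using hn 0 (by simp)) (fun u hu => hM u (by simp [hu]))
      (by simpa using fun u hu => hn u (by simp [hu]))
    have hind' := hind.symm.comp
      (φ := fun x (u : S) => x ⟨u + n • τ, Finset.mem_image_of_mem _ u.2⟩) (ψ := id) (by fun_prop) measurable_id
    have hmeas : Measurable fun (ω : WienerSpace T m) (u : S) => coord (u : T) ω - coord 0 ω :=
      measurable_pi_lambda _ fun u => (measurable_coord _).sub (measurable_coord _)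
    rw [← (hP.measurePreserving_shift hdist (n • τ)).measureReal_preimage
      (hmeas hA).nullMeasurableSet]
    have hpre : shift (n • τ) ⁻¹' ((fun (ω : WienerSpace T m) (u : S) =>
        coord (u : T) ω - coord 0 ω) ⁻¹' A) =
        ((fun x (u : S) => x ⟨u + n • τ, Finset.mem_image_of_mem _ u.2⟩) ∘
        fun (ω : WienerSpace T m) (u : S.image (· + n • τ)) =>
          coord (u : T) ω - coord (n • τ) ω) ⁻¹' A := by
      ext ω
      simp [coord_shift, Function.comp_def]
    beta_reduce
    rw [hpre]
    simp only [measureReal_def, ← ENNReal.toReal_mul]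
    exact congrArg _ (hind'.measure_inter_preimage_eq_mul _ _ hA hB).symm
  · rw [← shift_iterate]
    rw [Set.preimage_iterate_eq]
    exact Function.iterate_fixed hinv n

/-- The Wiener shift is an ergodic metric dynamical system, and so are its discretizations. -/
theorem isErgodicMetricDynamicalSystem [MeasurableSpace T] [BorelSpace T]
    (hdist : ∀ s t u : T, dist (s + u) (t + u) = dist s t)
    (htop : ∀ τ : T, 0 < τ → ∀ u : T, Tendsto (fun n : ℕ => u + n • τ) atTop atTop)
    (hpos : ∃ τ : T, 0 < τ) (hP : IsWienerMeasure P) :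
    IsErgodicMetricDynamicalSystem P (fun t : T => shift t) ∧
      ∀ τ : T, 0 < τ → IsErgodicMetricDynamicalSystem P (fun n : ℕ => (shift τ)^[n]) := by
  refine ⟨⟨⟨hP.isProbabilityMeasure, measurable_uncurry_shift, shift_zero, shift_add,
    hP.measurePreserving_shift hdist⟩, fun A hA hinv => ?_⟩, fun τ hτ =>
    ⟨⟨hP.isProbabilityMeasure, ?_, Function.iterate_zero _, Function.iterate_add _,
      (hP.measurePreserving_shift hdist τ).iterate⟩, fun A hA hinv => ?_⟩⟩
  · obtain ⟨τ, hτ⟩ := hpos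
    exact hP.measure_eq_zero_or_one hdist (htop τ hτ) hA (hinv τ)
  · exact measurable_from_prod_countable_right fun n => (measurable_shift τ).iterate n
  · exact hP.measure_eq_zero_or_one hdist (htop τ hτ) hA (hinv 1)

end IsWienerMeasure

theorem mainTheorem6 (m : ℕ) :
    (∀ P : Measure (WienerSpace ℝ≥0 m), IsWienerMeasure P →
      IsErgodicMetricDynamicalSystem P (fun t : ℝ≥0 => WienerSpace.shift t) ∧
      ∀ τ : ℝ≥0, 0 < τ →
        IsErgodicMetricDynamicalSystem P (fun n : ℕ => (WienerSpace.shift τ)^[n])) ∧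
    (∀ P : Measure (WienerSpace ℝ m), IsWienerMeasure P →
      IsErgodicMetricDynamicalSystem P (fun t : ℝ => WienerSpace.shift t) ∧
      ∀ τ : ℝ, 0 < τ →
        IsErgodicMetricDynamicalSystem P (fun n : ℕ => (WienerSpace.shift τ)^[n])) := by
  refine ⟨fun P hP => hP.isErgodicMetricDynamicalSystem (fun s t u => ?_) (fun τ hτ u => ?_)
      ⟨1, one_pos⟩,
    fun P hP => hP.isErgodicMetricDynamicalSystem (fun s t u => dist_add_right s t u)
      (fun τ hτ u => ?_) ⟨1, one_pos⟩⟩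
  · simp [NNReal.dist_eq]
  · refine tendsto_atTop_atTop_of_monotone
      (fun i j hij => add_le_add_right (nsmul_le_nsmul_left hτ.le hij) u) fun b => ?_
    -- As `u ≥ 0` in `ℝ≥0`, it suffices that `n • τ` alone reaches `b`.
    obtain ⟨n, hn⟩ := Archimedean.arch b hτ
    exact ⟨n, hn.trans le_add_self⟩
  · exact tendsto_atTop_add_const_left _ u (tendsto_id.atTop_nsmul_const hτ)
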